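/- All path and loop spaces carry the compact-open topology; $I=[0,1]$ and $S^I$ is the space of paths in $S$. For a continuous map $f:S\to O$ let $\triangle f=\{(s,\alpha)\in S\times O^I: f(s)=\alpha(0)\}$. A \emph{lifting function} for $f$ is a continuous map $L:\triangle f\to S^I$ with $L(s,\alpha)(0)=s$ and $f\circ L(s,\alpha)=\alpha$ for all $(s,\alpha)\in\triangle f$; it is \emph{regular} if it sends $(s,\text{constant path at }f(s))$ to the constant path at $s$ for every $s\in S$. A \emph{regular fibration} is a map that has a regular lifting function. Let $f_1:S_1\to O$ and $f_2:S_2\to O$ be regular fibrations with lifting functions $L_1,L_2$, let $r_o\in O$, and put $F^i=f_i^{-1}(r_o)$. The \emph{$Lf$-function} of $f_i$ is $\Theta_i:\Omega(O,r_o)\times F^i\to F^i$, $\Theta_i(\alpha,s)=L_i(s,\alpha)(1)$, and for $s\in F^i$ the \emph{$Lf$-restriction} is $f_i^{s}:\Omega(O,r_o)\to F^i$, $f_i^{s}(\alpha)=\Theta_i(\alpha,s)$. For $s\in F^i$ let $\Gamma(S_i,F^i,s)=\{\alpha\in S_i^I:\alpha(0)=s,\ \alpha(1)\in F^i\}$ and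 $\Psi_s:\Gamma(S_i,F^i,s)\to F^i$, $\Psi_s(\alpha)=\alpha(1)$. Let $g:F^1\to F^2$ be a homotopy equivalence with homotopy inverse $\bar g:F^2\to F^1$, and suppose that the $Lf$-functions are conjugate by $g$, that is, $\Theta_1\simeq \bar g\circ\Theta_2\circ(\mathrm{id}_{\Omega(O,r_o)}\times g)$ (homotopic maps). Then for every $s_o\in F^1$: (1) the $Lf$-restrictions $f_1^{s_o}$ and $f_2^{g(s_o)}$ are conjugate by $g$, that is, $f_1^{s_o}\simeq\bar g\circ f_2^{g(s_o)}$; (2) there are continuous maps $h:\Gamma(S_1,F^1,s_o)\to\Gamma(S_2,F^2,g(s_o))$ and $k:\Gamma(S_2,F^2,g(s_o))\to\Gamma(S_1,F^1,\bar g(g(s_o)))$ that are fiber maps over $g$ and $\bar g$ respectively, that is, $\Psi_{g(s_o)}\circ h=g\circ\Psi_{s_o}$ and $\Psi_{\bar g(g(s_o))}\circ k=\bar g\circ\Psi_{g(s_o)}$; (3) for every integer $n>1$ the groups $\pi_n(S_1,s_o)$ and $\pi_n(S_2,g(s_o))$ are isomorphic. -/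

import Mathlib

open scoped unitInterval ContinuousMap Topology

namespace LfFibration

variable {S S₁ S₂ O : Type*} [TopologicalSpace S] [TopologicalSpace S₁] [TopologicalSpace S₂]
  [TopologicalSpace O]

/-- `△f = {(s, α) ∈ S × O^I : f(s) = α(0)}`; path spaces `C(I, O)` carry the compact-open
topology. -/
def Delta (f : C(S, O)) : Set (S × C(I, O)) :=
  {p | f p.1 = p.2 0}

/-- A lifting function for `f`: a continuous map `L : △f → S^I` with `L(s, α)(0) = s` and
`f ∘ L(s, α) = α`.  A map is a (Hurewicz) fibration exactly when it has one. -/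
structure LiftingFunction (f : C(S, O)) where
  toMap : C(Delta f, C(I, S))
  map_zero : ∀ p : Delta f, toMap p 0 = p.1.1
  comp_map : ∀ p : Delta f, f.comp (toMap p) = p.1.2

/-- A lifting function is regular if it lifts constant paths to constant paths. -/
def LiftingFunction.IsRegular {f : C(S, O)} (L : LiftingFunction f) : Prop :=
  ∀ s : S, L.toMap ⟨(s, f.comp (ContinuousMap.const I s)), rfl⟩ = ContinuousMap.const I s

/-- A regular fibration: a map which has a regular lifting function. -/
def IsRegularFibration (f : C(S, O)) : Prop :=
  ∃ L : LiftingFunction f, L.IsRegular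

/-- The fiber `F_r = f⁻¹(r)`. -/
def Fiber (f : C(S, O)) (r : O) : Set S := f ⁻¹' {r}

/-- The `Lf`-function `Θ_L : Ω(O, r) × F_r → F_r`, `Θ_L(α, s) = L(s, α)(1)`.
The loop space `Ω(O, r)` is `Path r r`, a subspace of `C(I, O)`. -/
def lfFunction {f : C(S, O)} (L : LiftingFunction f) (r : O) :
    C(Path r r × Fiber f r, Fiber f r) where
  toFun p := ⟨L.toMap ⟨(p.2.1, p.1.toContinuousMap), by
      change f p.2.1 = p.1 0
      rw [p.1.source]; exact p.2.2⟩ 1, by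
    change f _ = r
    have h := DFunLike.congr_fun (L.comp_map ⟨(p.2.1, p.1.toContinuousMap), by
      change f p.2.1 = p.1 0
      rw [p.1.source]; exact p.2.2⟩) 1
    exact h.trans p.1.target⟩
  continuous_toFun := by
    refine Continuous.subtype_mk ?_ _
    refine (continuous_eval_const (1 : I)).comp (L.toMap.continuous.comp ?_)
    refine Continuous.subtype_mk ?_ _
    exact (continuous_subtype_val.comp continuous_snd).prodMk
      (continuous_induced_dom.comp continuous_fst)

/-- The `Lf`-restriction `f^s : Ω(O, r) → F_r`, `f^s(α) = Θ_L(α, s)`. -/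
def lfRestriction {f : C(S, O)} (L : LiftingFunction f) (r : O) (s : Fiber f r) :
    C(Path r r, Fiber f r) :=
  (lfFunction L r).comp ((ContinuousMap.id (Path r r)).prodMk (ContinuousMap.const (Path r r) s))

/-- The `Lf`-functions of `L₁`, `L₂` are conjugate by the homotopy equivalence `g` with homotopy
inverse `ḡ`: `Θ_{L₁} ≃ ḡ ∘ Θ_{L₂} ∘ (id × g)`. -/
def ConjugateLfFunctions {f₁ : C(S₁, O)} {f₂ : C(S₂, O)} (L₁ : LiftingFunction f₁)
    (L₂ : LiftingFunction f₂) (r : O) (g : Fiber f₁ r ≃ₕ Fiber f₂ r) : Prop :=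
  (lfFunction L₁ r).Homotopic
    (g.invFun.comp ((lfFunction L₂ r).comp ((ContinuousMap.id (Path r r)).prodMap g.toFun)))

/-- The `Lf`-restrictions `f₁^s` and `f₂^{g(s)}` are conjugate by the homotopy equivalence `g`
with homotopy inverse `ḡ`: `f₁^s ≃ ḡ ∘ f₂^{g(s)}`. -/
def ConjugateLfRestrictions {f₁ : C(S₁, O)} {f₂ : C(S₂, O)} (L₁ : LiftingFunction f₁)
    (L₂ : LiftingFunction f₂) (r : O) (g : Fiber f₁ r ≃ₕ Fiber f₂ r) (s : Fiber f₁ r) : Prop :=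
  (lfRestriction L₁ r s).Homotopic (g.invFun.comp (lfRestriction L₂ r (g.toFun s)))

/-- `Γ(S, F, s) = {α ∈ S^I : α(0) = s, α(1) ∈ F}` for a subspace `F` of `S` and `s ∈ F`. -/
def Gam (F : Set S) (s : F) : Set C(I, S) :=
  {α | α 0 = s ∧ α 1 ∈ F}

/-- The projection `Ψ_s : Γ(S, F, s) → F`, `Ψ_s(α) = α(1)`. -/
def gamProj (F : Set S) (s : F) : C(Gam F s, F) where
  toFun α := ⟨α.1 1, α.2.2⟩
  continuous_toFun := by
    refine Continuous.subtype_mk ?_ _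
    exact (continuous_eval_const (1 : I)).comp continuous_subtype_val

/-- The map `h` of total spaces is a fiber map from `p` to `q` over the map `g` of base spaces. -/
def IsFiberMapOver {X Y A B : Type*} [TopologicalSpace X] [TopologicalSpace Y]
    [TopologicalSpace A] [TopologicalSpace B] (p : C(X, A)) (q : C(Y, B))
    (h : C(X, Y)) (g : C(A, B)) : Prop :=
  q.comp h = g.comp p

end LfFibration

/-! Write `Ω` for the loops of `O` at `r`, and `Γᵢ` for the paths of `Sᵢ` that start at a chosen
point of the fiber and end in the fiber. Lifting loops and projecting paths make `Ω` and `Γᵢ`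
homotopy equivalent (`gamEquiv`), and under this equivalence the end point map `Ψ` corresponds to
the `Lf`-restriction. So `Ψ` and the `Lf`-restriction carry the same homotopy information.

Restricting the given homotopy to `Ω × {s}` gives (1). For (2), the conjugacy shows that `g ∘ Ψ` and
`ḡ ∘ Ψ` factor through the other end point map up to homotopy; since the end of a path may be
dragged along a homotopy inside the fiber, they factor strictly (`exists_gamProj_comp_eq`).

For (3), the homotopy fiber of `Ψ` over the base point is the loop space of `Sᵢ`, hence so is that
of the `Lf`-restriction. Homotopy fibers are treated as homotopy equalizers, which are invariant
under homotopies of the two maps (`isHEquiv_adjustMap`) and under equivalences of target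
(`isHEquiv_pushMap`) and source (`isHEquiv_pullMap`). Conjugacy thus yields `ΩS₁ ≃ ΩS₂`, and `π_n(S)
= π_{n-1}(ΩS)` finishes, once base points are corrected. -/

namespace LfFibration

/-- A continuous map which is a homotopy equivalence. -/
def IsHEquiv {X Y : Type*} [TopologicalSpace X] [TopologicalSpace Y] (f : C(X, Y)) : Prop :=
  ∃ g : C(Y, X), (g.comp f).Homotopic (.id X) ∧ (f.comp g).Homotopic (.id Y)

/-! ### Homotopy equivalences and the two-out-of-six property. -/

namespace IsHEquiv

variable {X Y Z W : Type*} [TopologicalSpace X] [TopologicalSpace Y] [TopologicalSpace Z]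
  [TopologicalSpace W]

theorem nonempty {f : C(X, Y)} (hf : IsHEquiv f) : Nonempty (X ≃ₕ Y) := by
  obtain ⟨g, h₁, h₂⟩ := hf
  exact ⟨⟨f, g, h₁, h₂⟩⟩

theorem congr {f f' : C(X, Y)} (hf : IsHEquiv f) (h : f.Homotopic f') : IsHEquiv f' := by
  obtain ⟨g, h₁, h₂⟩ := hf
  exact ⟨g, (ContinuousMap.Homotopic.comp (.refl g) h.symm).trans h₁,
    (ContinuousMap.Homotopic.comp h.symm (.refl g)).trans h₂⟩

/-- If `g ∘ f` and `h ∘ g` are homotopy equivalences, then so is `f`. -/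
theorem of_comp_of_comp {f : C(X, Y)} {g : C(Y, Z)} {h : C(Z, W)} (hgf : IsHEquiv (g.comp f))
    (hhg : IsHEquiv (h.comp g)) : IsHEquiv f := by
  obtain ⟨a, ha, ha'⟩ := hgf
  obtain ⟨b, hb, -⟩ := hhg
  refine ⟨a.comp g, ha, ?_⟩
  -- `f a g ≃ (b h g) f a g = b h (g f a) g ≃ b h g ≃ id`
  have h1 : (f.comp (a.comp g)).Homotopic ((b.comp (h.comp g)).comp (f.comp (a.comp g))) :=
    ContinuousMap.Homotopic.comp hb.symm (.refl (f.comp (a.comp g)))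
  have h2 : (((b.comp h).comp ((g.comp f).comp a)).comp g).Homotopic
      (((b.comp h).comp (.id Z)).comp g) :=
    ContinuousMap.Homotopic.comp (.comp (.refl (b.comp h)) ha') (.refl g)
  exact h1.trans (h2.trans hb)

/-- If `g ∘ f` and `h ∘ g` are homotopy equivalences, then so is `h`. -/
theorem of_comp_of_comp' {f : C(X, Y)} {g : C(Y, Z)} {h : C(Z, W)} (hgf : IsHEquiv (g.comp f))
    (hhg : IsHEquiv (h.comp g)) : IsHEquiv h := by
  obtain ⟨a, -, ha⟩ := hgf
  obtain ⟨b, hb, hb'⟩ := hhg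
  refine ⟨g.comp b, ?_, hb'⟩
  -- `g b h ≃ g b h (g f a) = g (b h g) f a ≃ g f a ≃ id`
  have h1 : ((g.comp (b.comp h)).comp (.id Z)).Homotopic
      ((g.comp (b.comp h)).comp ((g.comp f).comp a)) :=
    ContinuousMap.Homotopic.comp (.refl _) ha.symm
  have h2 : (g.comp ((b.comp (h.comp g)).comp (f.comp a))).Homotopic
      (g.comp ((ContinuousMap.id Y).comp (f.comp a))) :=
    ContinuousMap.Homotopic.comp (.refl g) (.comp hb (.refl (f.comp a)))
  exact h1.trans (h2.trans ha)

end IsHEquiv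

/-! ### Extending a path at both ends. -/

section Adjust

variable {B Z : Type*}

/-- The path running through `p` backwards from `p u` to `p 0`, then through `γ`, and then
through `q` from `q 0` to `q u`. -/
noncomputable def adjust (p γ q : I → B) (u t : I) : B :=
  if (1 + 2 * u : ℝ) * t - u ≤ 0 then p (Set.projIcc 0 1 zero_le_one (-((1 + 2 * u : ℝ) * t - u)))
  else if (1 + 2 * u : ℝ) * t - u ≤ 1 then γ (Set.projIcc 0 1 zero_le_one ((1 + 2 * u : ℝ) * t - u))
  else q (Set.projIcc 0 1 zero_le_one ((1 + 2 * u : ℝ) * t - u - 1))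

theorem projIcc_zero_of_le {x : ℝ} (hx : x ≤ 0) :
    Set.projIcc (0 : ℝ) 1 zero_le_one x = 0 := Set.projIcc_of_le_left _ hx

theorem projIcc_one_of_le {x : ℝ} (hx : 1 ≤ x) :
    Set.projIcc (0 : ℝ) 1 zero_le_one x = 1 := Set.projIcc_of_right_le _ hx

theorem continuous_adjust [TopologicalSpace B] [TopologicalSpace Z] {p γ q : Z → I → B} {u t : Z → I}
    (hp : Continuous fun z : Z × I => p z.1 z.2) (hγ : Continuous fun z : Z × I => γ z.1 z.2)
    (hq : Continuous fun z : Z × I => q z.1 z.2) (hu : Continuous u) (ht : Continuous t)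
    (h₀ : ∀ z, p z 0 = γ z 0) (h₁ : ∀ z, q z 0 = γ z 1) :
    Continuous fun z => adjust (p z) (γ z) (q z) (u z) (t z) := by
  have key : Continuous fun z => (1 + 2 * (u z) : ℝ) * (t z) - (u z) := by fun_prop
  have hproj := continuous_projIcc (a := (0 : ℝ)) (b := 1) (h := zero_le_one)
  refine Continuous.if_le ?_ (Continuous.if_le ?_ ?_ key continuous_const ?_) key
    continuous_const ?_
  · exact hp.comp (continuous_id.prodMk (hproj.comp key.neg))
  · exact hγ.comp (continuous_id.prodMk (hproj.comp key))
  · exact hq.comp (continuous_id.prodMk (hproj.comp (key.sub continuous_const)))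
  · intro z hz
    rw [hz, projIcc_one_of_le le_rfl, projIcc_zero_of_le (by simp), h₁]
  · intro z hz
    rw [hz, if_pos zero_le_one, projIcc_zero_of_le le_rfl, projIcc_zero_of_le (by simp), h₀]

theorem adjust_zero {p γ q : I → B} (h₀ : p 0 = γ 0) (t : I) : adjust p γ q 0 t = γ t := by
  have ht := t.2.2
  unfold adjust
  simp only [Set.Icc.coe_zero, mul_zero, add_zero, one_mul, sub_zero]
  split_ifs with h
  · have : t = 0 := le_antisymm (by exact_mod_cast h) t.2.1
    subst this
    rw [projIcc_zero_of_le (by simp), h₀]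
  · rw [Set.projIcc_val]

theorem adjust_source (p γ q : I → B) (u : I) : adjust p γ q u 0 = p u := by
  have := u.2.1
  unfold adjust
  rw [if_pos (by simpa using this)]
  simp

theorem adjust_target {p γ q : I → B} (h₁ : q 0 = γ 1) (u : I) : adjust p γ q u 1 = q u := by
  have h := u.2.1
  unfold adjust
  rw [if_neg (by simp; linarith)]
  split_ifs with h'
  · have hu : u = 0 := le_antisymm (by
      have : (u : ℝ) ≤ 0 := by simp at h'; linarith
      exact_mod_cast this) h
    subst hu
    rw [projIcc_one_of_le (by simp), h₁]
  · congr 1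
    have : ((1 + 2 * (u : ℝ)) * ((1 : I) : ℝ) - u - 1) = u := by simp; ring
    rw [this, Set.projIcc_val]

end Adjust

/-! ### Homotopy invariance of homotopy equalizers. -/

section HomotopyEqualizer

variable {A A' B B' Z : Type*} [TopologicalSpace A] [TopologicalSpace A'] [TopologicalSpace B]
  [TopologicalSpace B'] [TopologicalSpace Z]

/-- The homotopy equalizer of `φ, ψ : A → B`: points `a` of `A` together with a path in `B` from
`φ a` to `ψ a`. -/
def HomotopyEqualizer (φ ψ : C(A, B)) : Set (A × C(I, B)) :=
  {m | m.2 0 = φ m.1 ∧ m.2 1 = ψ m.1}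

namespace HomotopyEqualizer

variable {φ ψ φ' ψ' : C(A, B)}

/-- A map into a homotopy equalizer from its two components. -/
def lift (a : Z → A) (γ : Z → I → B) (ha : Continuous a)
    (hγ : Continuous fun z : Z × I => γ z.1 z.2) (h₀ : ∀ z, γ z 0 = φ (a z))
    (h₁ : ∀ z, γ z 1 = ψ (a z)) : C(Z, HomotopyEqualizer φ ψ) where
  toFun z := ⟨(a z, (ContinuousMap.mk _ hγ).curry z), h₀ z, h₁ z⟩
  continuous_toFun := by
    refine Continuous.subtype_mk (ha.prodMk ?_) _
    exact (ContinuousMap.mk _ hγ).curry.continuous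

theorem ext' {m m' : HomotopyEqualizer φ ψ} (h : m.1.1 = m'.1.1) (h' : ∀ t, m.1.2 t = m'.1.2 t) :
    m = m' :=
  Subtype.ext (Prod.ext h (ContinuousMap.ext h'))

/-- Maps into a homotopy equalizer are homotopic if there is a homotopy of their components. -/
theorem homotopic_of {F F' : C(Z, HomotopyEqualizer φ ψ)} (a : I → Z → A) (γ : I → Z → I → B)
    (ha : Continuous fun z : I × Z => a z.1 z.2)
    (hγ : Continuous fun z : (I × Z) × I => γ z.1.1 z.1.2 z.2)
    (h₀ : ∀ u z, γ u z 0 = φ (a u z)) (h₁ : ∀ u z, γ u z 1 = ψ (a u z))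
    (ha₀ : ∀ z, a 0 z = (F z).1.1) (ha₁ : ∀ z, a 1 z = (F' z).1.1)
    (hγ₀ : ∀ z t, γ 0 z t = (F z).1.2 t) (hγ₁ : ∀ z t, γ 1 z t = (F' z).1.2 t) :
    F.Homotopic F' :=
  ⟨{ toContinuousMap := lift (fun z : I × Z => a z.1 z.2) (fun z t => γ z.1 z.2 t) ha hγ
      (fun _ => h₀ _ _) (fun _ => h₁ _ _)
     map_zero_left := fun z => ext' (ha₀ z) (hγ₀ z)
     map_one_left := fun z => ext' (ha₁ z) (hγ₁ z) }⟩

/-- Homotopies of `φ` and `ψ` move the end points of the paths in a homotopy equalizer. -/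
noncomputable def adjustMap (H : φ.Homotopy φ') (K : ψ.Homotopy ψ') :
    C(HomotopyEqualizer φ ψ, HomotopyEqualizer φ' ψ') :=
  lift (fun m => m.1.1) (fun m t => adjust (fun u => H (u, m.1.1)) m.1.2 (fun u => K (u, m.1.1)) 1 t)
    (by fun_prop)
    (continuous_adjust (Z := HomotopyEqualizer φ ψ × I) (p := fun z u => H (u, z.1.1.1))
      (γ := fun z => z.1.1.2) (q := fun z u => K (u, z.1.1.1)) (u := fun _ => 1)
      (t := fun z => z.2) (by fun_prop) (by fun_prop) (by fun_prop) (by fun_prop) (by fun_prop)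
      (fun z => by simp [z.1.2.1]) (fun z => by simp [z.1.2.2]))
    (fun m => by simp [adjust_source])
    (fun m => by rw [adjust_target (by simp [m.2.2])]; simp)

/-- A homotopy of paths whose end points move along `H` and `K` ends at the result of
`adjustMap H K`, up to homotopy. -/
theorem adjustMap_comp_homotopic {H : φ.Homotopy φ'} {K : ψ.Homotopy ψ'}
    {F : C(Z, HomotopyEqualizer φ ψ)} {F' : C(Z, HomotopyEqualizer φ' ψ')}
    (hF : ∀ z, (F z).1.1 = (F' z).1.1) (G : Z → I → I → B)
    (hG : Continuous fun z : Z × I × I => G z.1 z.2.1 z.2.2)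
    (hG₀ : ∀ z t, G z 0 t = (F z).1.2 t) (hG₁ : ∀ z t, G z 1 t = (F' z).1.2 t)
    (hGs : ∀ z u, G z u 0 = H (u, (F z).1.1)) (hGt : ∀ z u, G z u 1 = K (u, (F z).1.1)) :
    ((adjustMap H K).comp F).Homotopic F' := by
  -- In the square of parameters of `G`, the adjusted path runs along three sides and `F'` along the
  -- fourth. Here `x` runs from `-(1 - v)` to `2 - v`; its overshoot beyond `[0, 1]` is the height
  -- climbed on a vertical side, and `e` adds `v` to it. At both ends the overshoot is `1 - v`, so
  -- `e = 1` and the end points stay fixed.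
  let x : I → I → ℝ := fun v t => (3 - 2 * v) * t - (1 - v)
  let e : I → I → ℝ := fun v t => v + (max (-(x v t)) 0 + max (x v t - 1) 0)
  have hproj := continuous_projIcc (a := (0 : ℝ)) (b := 1) (h := zero_le_one)
  refine homotopic_of (fun _ z => (F z).1.1)
    (fun v z t => G z (Set.projIcc 0 1 zero_le_one (e v t)) (Set.projIcc 0 1 zero_le_one (x v t)))
    (by fun_prop) ?_ ?_ ?_ (fun _ => rfl) hF ?_ ?_
  · refine hG.comp (.prodMk (by fun_prop) (.prodMk (hproj.comp ?_) (hproj.comp ?_))) <;>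
      simp only [e, x] <;> fun_prop
  · intro v z
    have := v.2.2
    have hx : x v 0 = -(1 - v) := by simp [x]
    have he : e v 0 = 1 := by
      simp only [e, hx]
      rw [max_eq_left (by linarith), max_eq_right (by linarith)]; ring
    rw [he, hx, projIcc_one_of_le le_rfl, projIcc_zero_of_le (by linarith), hGs]
    simp
  · intro v z
    have := v.2.2
    have hx : x v 1 = 2 - v := by simp [x]; ring
    have he : e v 1 = 1 := by
      simp only [e, hx]
      rw [max_eq_right (by linarith), max_eq_left (by linarith)]; ring
    rw [he, hx, projIcc_one_of_le le_rfl, projIcc_one_of_le (by linarith), hGt]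
    simp
  · intro z t
    have hx : (1 + 2 * ((1 : I) : ℝ)) * t - (1 : I) = x 0 t := by simp only [x, Set.Icc.coe_zero, Set.Icc.coe_one]; ring
    change _ = adjust (fun u => H (u, (F z).1.1)) (F z).1.2 (fun u => K (u, (F z).1.1)) 1 t
    rw [adjust, hx]
    simp only [e, Set.Icc.coe_zero, zero_add]
    split_ifs with h h'
    · rw [max_eq_left (by linarith), max_eq_right (by linarith), projIcc_zero_of_le h, hGs,
        add_zero]
    · rw [max_eq_right (by linarith), max_eq_right (by linarith), projIcc_zero_of_le (by simp),
        hG₀]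
    · rw [max_eq_right (by linarith), max_eq_left (by linarith),
        projIcc_one_of_le (x := x 0 t) (by linarith), hGt, zero_add]
  · intro z t
    have hx : x 1 t = t := by simp [x]; ring
    have he : 1 ≤ e 1 t := by
      simp only [e, Set.Icc.coe_one]
      have := le_max_right (-(x 1 t)) 0
      have := le_max_right (x 1 t - 1) 0
      linarith
    rw [projIcc_one_of_le he, hx, Set.projIcc_val, hG₁]

/-- The added legs are retracted: `adjust` with parameter `σ u` shrinks them to nothing, and its end
points move along the reversed homotopies. -/
theorem adjustMap_symm_comp (H : φ.Homotopy φ') (K : ψ.Homotopy ψ') :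
    ((adjustMap H.symm K.symm).comp (adjustMap H K)).Homotopic (.id _) := by
  refine adjustMap_comp_homotopic (fun _ => rfl)
    (fun m u t => adjust (fun u => H (u, m.1.1)) m.1.2 (fun u => K (u, m.1.1)) (σ u) t) ?_ ?_ ?_
    ?_ ?_
  · exact continuous_adjust (Z := HomotopyEqualizer φ ψ × I × I)
      (p := fun z u => H (u, z.1.1.1)) (γ := fun z => z.1.1.2) (q := fun z u => K (u, z.1.1.1))
      (u := fun z => σ z.2.1) (t := fun z => z.2.2) (by fun_prop) (by fun_prop) (by fun_prop)
      (by fun_prop) (by fun_prop) (fun z => by simp [z.1.2.1]) (fun z => by simp [z.1.2.2])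
  · intro m t
    simp only [unitInterval.symm_zero]
    rfl
  · intro m t
    simp only [unitInterval.symm_one]
    exact adjust_zero (by simp [m.2.1]) t
  · intro m u
    rw [adjust_source, ContinuousMap.Homotopy.symm_apply]
    rfl
  · intro m u
    rw [adjust_target (by simp [m.2.2]), ContinuousMap.Homotopy.symm_apply]
    rfl

theorem isHEquiv_adjustMap (H : φ.Homotopy φ') (K : ψ.Homotopy ψ') :
    IsHEquiv (adjustMap H K) := by
  refine ⟨adjustMap H.symm K.symm, adjustMap_symm_comp H K, ?_⟩
  simpa only [ContinuousMap.Homotopy.symm_symm] using adjustMap_symm_comp H.symm K.symm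

/-- Postcomposition of the paths with a map `e : B → B'`. -/
def pushMap {φ' ψ' : C(A, B')} (e : C(B, B')) (hφ : ∀ a, e (φ a) = φ' a)
    (hψ : ∀ a, e (ψ a) = ψ' a) : C(HomotopyEqualizer φ ψ, HomotopyEqualizer φ' ψ') :=
  lift (fun m => m.1.1) (fun m t => e (m.1.2 t)) (by fun_prop) (by fun_prop)
    (fun m => by rw [m.2.1, hφ]) (fun m => by rw [m.2.2, hψ])

/-- Moving a whole path by `H` drags its end points along `H`, so the push is homotopic to the
`adjustMap` of these end point tracks. -/
theorem isHEquiv_pushMap_of_homotopy_id {ε : C(B, B)} (H : (ContinuousMap.id B).Homotopy ε)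
    (hφ : ∀ a, ε (φ a) = φ' a) (hψ : ∀ a, ε (ψ a) = ψ' a) : IsHEquiv (pushMap ε hφ hψ) := by
  let move (χ χ' : C(A, B)) (h : ∀ a, ε (χ a) = χ' a) : χ.Homotopy χ' :=
    { toFun := fun z => H (z.1, χ z.2)
      continuous_toFun := by fun_prop
      map_zero_left := by simp
      map_one_left := by simp [h] }
  refine (isHEquiv_adjustMap (move φ φ' hφ) (move ψ ψ' hψ)).congr ?_
  refine adjustMap_comp_homotopic (F := .id _) (fun _ => rfl) (fun m u t => H (u, m.1.2 t))
    (by fun_prop) (fun m t => by simp) (fun m t => ?_) (fun m u => ?_) (fun m u => ?_)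
  · rw [H.apply_one]; rfl
  · rw [m.2.1]; rfl
  · rw [m.2.2]; rfl

/-- Two-out-of-six for the pushes along `e`, its inverse and `e` again: the inverse alone does not
return to the original end points, but both composites are pushes along maps homotopic to the
identity. -/
theorem isHEquiv_pushMap {φ' ψ' : C(A, B')} (e : B ≃ₕ B') (hφ : ∀ a, e.toFun (φ a) = φ' a)
    (hψ : ∀ a, e.toFun (ψ a) = ψ' a) : IsHEquiv (pushMap e.toFun hφ hψ) := by
  obtain ⟨H⟩ := e.left_inv.symm
  obtain ⟨K⟩ := e.right_inv.symm
  refine IsHEquiv.of_comp_of_comp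
    (g := pushMap (φ' := e.invFun.comp φ') (ψ' := e.invFun.comp ψ') e.invFun
      (fun _ => rfl) (fun _ => rfl))
    (h := pushMap (φ' := e.toFun.comp (e.invFun.comp φ'))
      (ψ' := e.toFun.comp (e.invFun.comp ψ')) e.toFun (fun _ => rfl) (fun _ => rfl)) ?_ ?_
  · exact isHEquiv_pushMap_of_homotopy_id H (fun a => by simp [← hφ]) (fun a => by simp [← hψ])
  · exact isHEquiv_pushMap_of_homotopy_id K (fun a => by simp) (fun a => by simp)

/-- Base change of a homotopy equalizer along `e : A' → A`. -/
def pullMap {φ' ψ' : C(A', B)} (e : C(A', A)) (hφ : ∀ a, φ (e a) = φ' a)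
    (hψ : ∀ a, ψ (e a) = ψ' a) : C(HomotopyEqualizer φ' ψ', HomotopyEqualizer φ ψ) :=
  lift (fun m => e m.1.1) (fun m => m.1.2) (by fun_prop) (by fun_prop)
    (fun m => by rw [m.2.1, hφ]) (fun m => by rw [m.2.2, hψ])

/-- Sliding the point from `ε a` to `a` along `H`, while the path grows legs to keep up, deforms the
base change into an `adjustMap`. -/
theorem isHEquiv_pullMap_of_homotopy_id {ε : C(A, A)} (H : ε.Homotopy (.id A))
    (hφ : ∀ a, φ (ε a) = φ' a) (hψ : ∀ a, ψ (ε a) = ψ' a) : IsHEquiv (pullMap ε hφ hψ) := by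
  let move (χ χ' : C(A, B)) (h : ∀ a, χ (ε a) = χ' a) : χ'.Homotopy χ :=
    { toFun := fun z => χ (H z)
      continuous_toFun := by fun_prop
      map_zero_left := by simp [h]
      map_one_left := by simp }
  refine (isHEquiv_adjustMap (move φ φ' hφ) (move ψ ψ' hψ)).congr (.symm ?_)
  refine homotopic_of (fun u m => H (u, m.1.1))
    (fun u m t => adjust (fun u => φ (H (u, m.1.1))) m.1.2 (fun u => ψ (H (u, m.1.1))) u t)
    (by fun_prop) ?_ (fun u m => adjust_source _ _ _ u)
    (fun u m => adjust_target (by simp [m.2.2, hψ]) u) (fun m => H.apply_zero _)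
    (fun m => H.apply_one _) (fun m t => adjust_zero (by simp [m.2.1, hφ]) t) (fun m t => rfl)
  exact continuous_adjust (Z := (I × HomotopyEqualizer φ' ψ') × I)
    (p := fun z u => φ (H (u, z.1.2.1.1))) (γ := fun z => z.1.2.1.2)
    (q := fun z u => ψ (H (u, z.1.2.1.1))) (u := fun z => z.1.1) (t := fun z => z.2)
    (by fun_prop) (by fun_prop) (by fun_prop) (by fun_prop) (by fun_prop)
    (fun z => by simp [z.1.2.2.1, hφ]) (fun z => by simp [z.1.2.2.2, hψ])

theorem isHEquiv_pullMap {φ' ψ' : C(A', B)} (e : A' ≃ₕ A) (hφ : ∀ a, φ (e.toFun a) = φ' a)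
    (hψ : ∀ a, ψ (e.toFun a) = ψ' a) : IsHEquiv (pullMap e.toFun hφ hψ) := by
  obtain ⟨H⟩ := e.left_inv
  obtain ⟨K⟩ := e.right_inv
  let P := pullMap (φ := φ) (ψ := ψ) e.toFun hφ hψ
  let Q := pullMap (φ := φ') (ψ := ψ') (φ' := φ'.comp e.invFun) (ψ' := ψ'.comp e.invFun) e.invFun
    (fun _ => rfl) (fun _ => rfl)
  let R := pullMap (φ := φ'.comp e.invFun) (ψ := ψ'.comp e.invFun)
    (φ' := (φ'.comp e.invFun).comp e.toFun) (ψ' := (ψ'.comp e.invFun).comp e.toFun) e.toFun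
    (fun _ => rfl) (fun _ => rfl)
  have hPQ : IsHEquiv (P.comp Q) :=
    isHEquiv_pullMap_of_homotopy_id K (fun a => by simp [← hφ]) (fun a => by simp [← hψ])
  have hQR : IsHEquiv (Q.comp R) :=
    isHEquiv_pullMap_of_homotopy_id H (fun a => by simp) (fun a => by simp)
  exact hQR.of_comp_of_comp' hPQ

end HomotopyEqualizer

end HomotopyEqualizer

/-! ### Comparing homotopy groups through spaces of generalized loops. -/

section HomotopyGroups

variable {M N X Y : Type*} [TopologicalSpace X] [TopologicalSpace Y] {x x' : X} {y : Y}

/-- Currying turns a homotopy relative to the boundary into a path of loops. Hence every continuous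
map of loop spaces respects homotopy classes. -/
theorem genLoop_homotopic_iff_joined {f g : GenLoop N X x} :
    GenLoop.Homotopic f g ↔ Joined f g := by
  constructor
  · rintro ⟨H⟩
    refine ⟨⟨⟨fun t => ⟨H.toHomotopy.curry t, fun z hz => ?_⟩, ?_⟩, ?_, ?_⟩⟩
    · exact (H.eq_fst t hz).trans (f.2 z hz)
    · exact Continuous.subtype_mk H.toHomotopy.curry.continuous _
    · ext z; exact H.apply_zero z
    · ext z; exact H.apply_one z
  · rintro ⟨γ⟩
    refine ⟨⟨⟨⟨fun z => γ z.1 z.2, ?_⟩, fun z => ?_, fun z => ?_⟩, fun t z hz => ?_⟩⟩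
    · exact (γ.continuous.comp continuous_fst).eval continuous_snd
    · exact congrArg (fun f : GenLoop N X x => f z) γ.source
    · exact congrArg (fun f : GenLoop N X x => f z) γ.target
    · exact ((γ t).2 z hz).trans (f.2 z hz).symm

theorem genLoop_homotopic_map {Φ : GenLoop M X x → GenLoop N Y y} (hΦ : Continuous Φ)
    {f g : GenLoop M X x} (h : GenLoop.Homotopic f g) : GenLoop.Homotopic (Φ f) (Φ g) := by
  rw [genLoop_homotopic_iff_joined] at h ⊢
  exact h.map hΦ

/-- A continuous map between spaces of generalized loops which is bijective on homotopy classes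
and compatible with concatenation induces an isomorphism of homotopy groups. -/
theorem nonempty_mulEquiv_of_genLoop [DecidableEq M] [DecidableEq N] [Nonempty M] [Nonempty N]
    {Φ : GenLoop M X x → GenLoop N Y y} (hΦ : Continuous Φ)
    (hinj : ∀ f g, GenLoop.Homotopic (Φ f) (Φ g) → GenLoop.Homotopic f g)
    (hsurj : ∀ g, ∃ f, GenLoop.Homotopic (Φ f) g) (i : M) (j : N)
    (hmul : ∀ f g, GenLoop.Homotopic (Φ (GenLoop.transAt i f g))
      (GenLoop.transAt j (Φ f) (Φ g))) :
    Nonempty (HomotopyGroup M X x ≃* HomotopyGroup N Y y) := by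
  let T : HomotopyGroup M X x → HomotopyGroup N Y y :=
    Quotient.map Φ fun _ _ h => genLoop_homotopic_map hΦ h
  have hT : ∀ a b, T (a * b) = T a * T b := by
    rintro ⟨a⟩ ⟨b⟩
    -- `a * b` is represented by concatenating `b` before `a`, in any chosen coordinate; hence the
    -- swapped arguments of `hmul`.
    have h1 := HomotopyGroup.mul_spec (i := i) (p := a) (q := b)
    have h2 := HomotopyGroup.mul_spec (i := j) (p := Φ a) (q := Φ b)
    exact (congrArg T h1).trans ((Quotient.sound (hmul b a)).trans h2.symm)
  refine ⟨MulEquiv.ofBijective (MulHom.mk T hT) ⟨?_, ?_⟩⟩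
  · rintro ⟨a⟩ ⟨b⟩ h
    exact Quotient.sound (hinj a b (Quotient.exact h))
  · rintro ⟨b⟩
    obtain ⟨a, ha⟩ := hsurj b
    exact ⟨Quotient.mk _ a, Quotient.sound ha⟩

theorem nonempty_mulEquiv_of_genLoop_homeomorph [DecidableEq M] [DecidableEq N] [Nonempty M]
    [Nonempty N] (Φ : GenLoop M X x ≃ₜ GenLoop N Y y) (i : M) (j : N)
    (hmul : ∀ f g, Φ (GenLoop.transAt i f g) = GenLoop.transAt j (Φ f) (Φ g)) :
    Nonempty (HomotopyGroup M X x ≃* HomotopyGroup N Y y) := by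
  refine nonempty_mulEquiv_of_genLoop Φ.continuous (fun f g h => ?_)
    (fun g => ⟨Φ.symm g, by rw [Φ.apply_symm_apply]⟩) i j (fun f g => by rw [hmul])
  simpa using genLoop_homotopic_map Φ.symm.continuous h

theorem transAt_apply [DecidableEq N] (i : N) (f g : GenLoop N X x) (t : N → I) :
    GenLoop.transAt i f g t = if (t i : ℝ) ≤ 1 / 2
      then f (Function.update t i (Set.projIcc 0 1 zero_le_one (2 * t i)))
      else g (Function.update t i (Set.projIcc 0 1 zero_le_one (2 * t i - 1))) := rfl

/-- Homotopy groups only depend on the cardinality of the index type. -/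
theorem nonempty_mulEquiv_of_equiv [DecidableEq M] [DecidableEq N] [Nonempty M] [Nonempty N]
    (e : M ≃ N) : Nonempty (HomotopyGroup M X x ≃* HomotopyGroup N X x) := by
  have i : M := Classical.arbitrary M
  have key (t : N → I) (s : I) : (fun m => Function.update t (e i) s (e m)) =
      Function.update (fun m => t (e m)) i s := by
    ext m
    by_cases h : m = i
    · subst h; simp
    · simp [h]
  refine nonempty_mulEquiv_of_genLoop_homeomorph (GenLoop.congr x e) i (e i) fun f g => ?_
  ext t
  change GenLoop.transAt i f g (fun m => t (e m)) = _
  rw [transAt_apply, transAt_apply]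
  change _ = if _ then f (fun m => Function.update t (e i) _ (e m))
    else g (fun m => Function.update t (e i) _ (e m))
  rw [key, key]

/-- `π_{M ⊔ N}(X) = π_M(Ω^N X)`. -/
theorem nonempty_mulEquiv_genLoop [DecidableEq M] [DecidableEq N] [Nonempty M] :
    Nonempty (HomotopyGroup M (GenLoop N X x) GenLoop.const ≃* HomotopyGroup (M ⊕ N) X x) := by
  have i : M := Classical.arbitrary M
  have inl (t : M ⊕ N → I) (s : I) : (fun m => Function.update t (Sum.inl i) s (Sum.inl m)) =
      Function.update (fun m => t (Sum.inl m)) i s := by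
    ext m
    by_cases h : m = i
    · subst h; simp
    · simp [h]
  refine nonempty_mulEquiv_of_genLoop_homeomorph (GenLoop.genLoopGenLoopEquiv x) i (Sum.inl i)
    fun f g => ?_
  ext t
  have hap (F : GenLoop M (GenLoop N X x) GenLoop.const) (t : M ⊕ N → I) :
      GenLoop.genLoopGenLoopEquiv x F t =
        F (fun m => t (Sum.inl m)) (fun n => t (Sum.inr n)) := rfl
  rw [hap, transAt_apply, transAt_apply, hap, hap, inl, inl]
  split_ifs <;> simp

/-! ### Change of base point and homotopy invariance of homotopy groups. -/

section Transport

variable [Fintype N]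

/-- Rescaling of the cube about its centre, cut off at the boundary. -/
noncomputable def cubeScale (s : ℝ) (z : N → I) : N → I :=
  fun i => Set.projIcc 0 1 zero_le_one (s * (z i - 1 / 2) + 1 / 2)

/-- The distance from the centre of the cube, normalized to be `1` on the boundary. -/
noncomputable def cubeRadius (z : N → I) : ℝ := ‖fun i => 2 * (z i : ℝ) - 1‖

omit [Fintype N] in
theorem continuous_cubeScale : Continuous fun z : ℝ × (N → I) => cubeScale z.1 z.2 := by
  refine continuous_pi fun i => (continuous_projIcc (h := zero_le_one)).comp ?_
  fun_prop

theorem continuous_cubeRadius : Continuous (cubeRadius : (N → I) → ℝ) := by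
  unfold cubeRadius
  fun_prop

omit [Fintype N] in
theorem cubeScale_one (z : N → I) : cubeScale 1 z = z := by
  ext i
  simp [cubeScale]

theorem abs_two_mul_sub_one_le (a : I) : |2 * (a : ℝ) - 1| ≤ 1 := by
  have := a.2.1
  have := a.2.2
  rw [abs_le]; constructor <;> linarith

theorem cubeRadius_le_one (z : N → I) : cubeRadius z ≤ 1 :=
  (pi_norm_le_iff_of_nonneg zero_le_one).2 fun i => abs_two_mul_sub_one_le (z i)

theorem cubeRadius_of_mem_boundary {z : N → I} (hz : z ∈ Cube.boundary N) : cubeRadius z = 1 := by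
  refine le_antisymm (cubeRadius_le_one z) ?_
  obtain ⟨i, hi⟩ := hz
  refine le_trans ?_ (norm_le_pi_norm (fun i => 2 * (z i : ℝ) - 1) i)
  rcases hi with hi | hi <;> norm_num [hi]

/-- The radius is a sup norm, attained at some coordinate; after scaling, that coordinate is cut off
at `0` or `1`. -/
theorem cubeScale_mem_boundary {s : ℝ} (hs : 0 ≤ s) {z : N → I} (h : 1 ≤ s * cubeRadius z) :
    cubeScale s z ∈ Cube.boundary N := by
  have hne : Nonempty N := by
    by_contra hN
    rw [not_nonempty_iff] at hN
    have : cubeRadius z = 0 := by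
      rw [cubeRadius, Subsingleton.elim (fun i => 2 * (z i : ℝ) - 1) 0, norm_zero]
    rw [this] at h
    norm_num at h
  obtain ⟨i, hi⟩ : ∃ i, cubeRadius z ≤ |2 * (z i : ℝ) - 1| := by
    by_contra! hlt
    have hpos : 0 < cubeRadius z := (abs_nonneg _).trans_lt (hlt (Classical.arbitrary N))
    exact lt_irrefl _ ((pi_norm_lt_iff hpos).2 hlt)
  have h' : 1 ≤ s * |2 * (z i : ℝ) - 1| := h.trans (by gcongr)
  refine ⟨i, ?_⟩
  rcases abs_cases (2 * (z i : ℝ) - 1) with ⟨ha, -⟩ | ⟨ha, -⟩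
  · right
    rw [ha] at h'
    exact projIcc_one_of_le (by linarith)
  · left
    rw [ha] at h'
    exact projIcc_zero_of_le (by linarith)

/-- The free homotopy from `f` whose value on the boundary follows the path `p`. -/
noncomputable def collar (p : Path x x') (f : GenLoop N X x) (t : I) (z : N → I) : X :=
  if (1 + t : ℝ) * cubeRadius z ≤ 1 then f (cubeScale (1 + t) z)
  else p (Set.projIcc 0 1 zero_le_one ((1 + t : ℝ) * cubeRadius z - 1))

theorem continuous_collar (p : Path x x') :
    Continuous fun w : GenLoop N X x × I × (N → I) => collar p w.1 w.2.1 w.2.2 := by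
  have hr : Continuous fun w : GenLoop N X x × I × (N → I) =>
      (1 + w.2.1 : ℝ) * cubeRadius w.2.2 :=
    Continuous.mul (by fun_prop) (continuous_cubeRadius.comp (by fun_prop))
  refine Continuous.if_le ?_ ?_ hr continuous_const ?_
  · exact continuous_fst.eval (continuous_cubeScale.comp
      (f := fun w : GenLoop N X x × I × (N → I) => ((1 + w.2.1 : ℝ), w.2.2)) (by fun_prop))
  · exact p.continuous.comp ((continuous_projIcc (h := zero_le_one)).comp
      (hr.sub continuous_const))
  · rintro ⟨f, t, z⟩ h
    have := t.2.1
    rw [GenLoop.boundary _ _ (cubeScale_mem_boundary (by linarith) h.ge), h,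
      projIcc_zero_of_le (by simp), p.source]

theorem collar_of_mem_boundary (p : Path x x') (f : GenLoop N X x) (t : I) {z : N → I}
    (hz : z ∈ Cube.boundary N) : collar p f t z = p t := by
  have ht := t.2.1
  rw [collar, cubeRadius_of_mem_boundary hz]
  split_ifs with h
  · have : t = 0 := le_antisymm (by
      have : (t : ℝ) ≤ 0 := by linarith
      exact_mod_cast this) ht
    subst this
    rw [GenLoop.boundary _ _ (cubeScale_mem_boundary (by norm_num)
      (by simp [cubeRadius_of_mem_boundary hz])), p.source]
  · simp

/-- Transport of generalized loops along a path. -/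
noncomputable def transport (p : Path x x') (f : GenLoop N X x) : GenLoop N X x' :=
  ⟨⟨fun z => collar p f 1 z, (continuous_collar p).comp
    (f := fun z : N → I => (f, (1 : I), z)) (by fun_prop)⟩,
    fun z hz => (collar_of_mem_boundary p f 1 hz).trans p.target⟩

theorem continuous_transport (p : Path x x') :
    Continuous (transport p : GenLoop N X x → GenLoop N X x') := by
  refine Continuous.subtype_mk (ContinuousMap.continuous_of_continuous_uncurry _ ?_) _
  exact (continuous_collar p).comp
    (f := fun w : GenLoop N X x × (N → I) => (w.1, (1 : I), w.2)) (by fun_prop)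

/-- The generalized loops `f` and `g` are homotopic through maps whose value on the boundary
follows the path `p`. -/
def FreelyHomotopic (p : Path x x') (f : GenLoop N X x) (g : GenLoop N X x') : Prop :=
  ∃ G : I → (N → I) → X, Continuous (fun w : I × (N → I) => G w.1 w.2) ∧
    (∀ z, G 0 z = f z) ∧ (∀ z, G 1 z = g z) ∧ ∀ t, ∀ z ∈ Cube.boundary N, G t z = p t

theorem freelyHomotopic_transport (p : Path x x') (f : GenLoop N X x) :
    FreelyHomotopic p f (transport p f) := by
  refine ⟨collar p f, (continuous_collar p).comp
    (f := fun w : I × (N → I) => (f, w.1, w.2)) (by fun_prop), fun z => ?_, fun z => rfl,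
    fun t z hz => collar_of_mem_boundary p f t hz⟩
  simp [collar, cubeRadius_le_one, cubeScale_one]

omit [Fintype N] in
theorem FreelyHomotopic.symm {p : Path x x'} {f : GenLoop N X x} {g : GenLoop N X x'}
    (h : FreelyHomotopic p f g) : FreelyHomotopic p.symm g f := by
  obtain ⟨G, hG, h₀, h₁, hb⟩ := h
  exact ⟨fun t z => G (σ t) z, hG.comp (f := fun w : I × (N → I) => (σ w.1, w.2)) (by fun_prop),
    fun z => by simp [h₁], fun z => by simp [h₀], fun t z hz => hb (σ t) z hz⟩

/-- Transport is determined up to homotopy by any free homotopy along `p`. The deformation is that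
of `adjustMap_comp_homotopic`, with the radius of the cube in place of the path parameter: `e`
equals `1` on the boundary, where the value therefore stays `x'`. -/
theorem FreelyHomotopic.transport_homotopic {p : Path x x'} {f : GenLoop N X x}
    {g : GenLoop N X x'} (h : FreelyHomotopic p f g) : GenLoop.Homotopic (transport p f) g := by
  obtain ⟨G, hG, h₀, h₁, hb⟩ := h
  let e : I → (N → I) → ℝ := fun v z => v + max ((2 - v) * cubeRadius z - 1) 0
  have he : Continuous fun w : I × (N → I) => e w.1 w.2 := by
    have := (continuous_cubeRadius (N := N)).comp (continuous_snd (X := I))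
    simp only [e]
    fun_prop
  have hKb : ∀ (v : I) (z : N → I), z ∈ Cube.boundary N →
      G (Set.projIcc 0 1 zero_le_one (e v z)) (cubeScale (2 - v) z) = x' := by
    intro v z hz
    have hv := v.2.2
    have hr := cubeRadius_of_mem_boundary hz
    have : e v z = 1 := by
      simp only [e, hr]
      rw [max_eq_left (by linarith)]
      ring
    rw [hb _ _ (cubeScale_mem_boundary (by linarith) (by rw [hr]; linarith)), this,
      projIcc_one_of_le le_rfl, p.target]
  refine ⟨⟨⟨⟨fun w => G (Set.projIcc 0 1 zero_le_one (e w.1 w.2)) (cubeScale (2 - w.1) w.2), ?_⟩,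
    fun z => ?_, fun z => ?_⟩, fun v z hz => ?_⟩⟩
  · exact hG.comp (.prodMk ((continuous_projIcc (h := zero_le_one)).comp he)
      (continuous_cubeScale.comp (f := fun w : I × (N → I) => ((2 - w.1 : ℝ), w.2))
        (by fun_prop)))
  · change G (Set.projIcc 0 1 zero_le_one (e 0 z)) (cubeScale (2 - (0 : I)) z) = collar p f 1 z
    have h2 : (1 + ((1 : I) : ℝ)) = 2 := by norm_num
    simp only [e, collar, h2, Set.Icc.coe_zero, sub_zero, zero_add]
    split_ifs with h
    · rw [max_eq_right (by linarith), projIcc_zero_of_le le_rfl, h₀]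
    · rw [max_eq_left (by linarith),
        hb _ _ (cubeScale_mem_boundary (by norm_num) (le_of_not_ge h))]
  · change G (Set.projIcc 0 1 zero_le_one (e 1 z)) (cubeScale (2 - (1 : I)) z) = g z
    have h2 : (2 - ((1 : I) : ℝ)) = 1 := by norm_num
    have hle : 1 ≤ e 1 z := by simp [e]
    rw [projIcc_one_of_le hle, h2, cubeScale_one, h₁]
  · exact (hKb v z hz).trans ((transport p f).2 z hz).symm

theorem transport_symm_transport (p : Path x x') (f : GenLoop N X x) :
    GenLoop.Homotopic (transport p.symm (transport p f)) f :=
  (freelyHomotopic_transport p f).symm.transport_homotopic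

theorem homotopic_of_transport {p : Path x x'} {f g : GenLoop N X x}
    (h : GenLoop.Homotopic (transport p f) (transport p g)) : GenLoop.Homotopic f g :=
  (transport_symm_transport p f).symm.trans
    ((genLoop_homotopic_map (continuous_transport p.symm) h).trans (transport_symm_transport p g))

theorem exists_transport_homotopic (p : Path x x') (g : GenLoop N X x') :
    ∃ f, GenLoop.Homotopic (transport p f) g :=
  ⟨transport p.symm g, by simpa using transport_symm_transport p.symm g⟩

omit [Fintype N] in
theorem FreelyHomotopic.transAt [DecidableEq N] {p : Path x x'} {f f' : GenLoop N X x}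
    {g g' : GenLoop N X x'} (h : FreelyHomotopic p f g) (h' : FreelyHomotopic p f' g') (i : N) :
    FreelyHomotopic p (GenLoop.transAt i f f') (GenLoop.transAt i g g') := by
  obtain ⟨G, hG, h₀, h₁, hb⟩ := h
  obtain ⟨G', hG', h₀', h₁', hb'⟩ := h'
  have hproj := continuous_projIcc (a := (0 : ℝ)) (b := 1) (h := zero_le_one)
  have mem_of_ne {z : N → I} {j : N} (hj : z j = 0 ∨ z j = 1) (hji : j ≠ i) (s : I) :
      Function.update z i s ∈ Cube.boundary N := ⟨j, by simpa [hji] using hj⟩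
  refine ⟨fun t z => if (z i : ℝ) ≤ 1 / 2
      then G t (Function.update z i (Set.projIcc 0 1 zero_le_one (2 * z i)))
      else G' t (Function.update z i (Set.projIcc 0 1 zero_le_one (2 * z i - 1))),
    Continuous.if_le ?_ ?_ (by fun_prop) continuous_const ?_, fun z => ?_, fun z => ?_, ?_⟩
  · exact hG.comp (continuous_fst.prodMk (continuous_snd.update i (hproj.comp (by fun_prop))))
  · exact hG'.comp (continuous_fst.prodMk (continuous_snd.update i (hproj.comp (by fun_prop))))
  -- On the wall `z i = 1/2` both halves are evaluated on the boundary of the cube, so both equal `p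
  -- t`.
  · rintro ⟨t, z⟩ h
    simp only at h
    rw [hb _ _ ⟨i, .inr ?_⟩, hb' _ _ ⟨i, .inl ?_⟩]
    · rw [Function.update_self, h, projIcc_zero_of_le (by norm_num)]
    · rw [Function.update_self, h, projIcc_one_of_le (by norm_num)]
  · simp only [h₀, h₀', transAt_apply]
  · simp only [h₁, h₁', transAt_apply]
  · rintro t z ⟨j, hj⟩
    by_cases hji : j = i
    · subst hji
      rcases hj with hj | hj
      · beta_reduce
        rw [hj, if_pos (by norm_num)]
        exact hb _ _ ⟨j, .inl (by simp)⟩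
      · beta_reduce
        rw [hj, if_neg (by norm_num)]
        refine hb' _ _ ⟨j, .inr ?_⟩
        rw [Function.update_self, projIcc_one_of_le (by norm_num)]
    · beta_reduce
      split_ifs
      · exact hb _ _ (mem_of_ne hj hji _)
      · exact hb' _ _ (mem_of_ne hj hji _)

/-- Homotopy groups at base points in the same path component are isomorphic. -/
theorem nonempty_mulEquiv_of_joined [DecidableEq N] [Nonempty N] (h : Joined x x') :
    Nonempty (HomotopyGroup N X x ≃* HomotopyGroup N X x') := by
  obtain ⟨p⟩ := h
  exact nonempty_mulEquiv_of_genLoop (continuous_transport p) (fun _ _ => homotopic_of_transport)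
    (exists_transport_homotopic p) (Classical.arbitrary N) (Classical.arbitrary N) fun f g =>
      ((freelyHomotopic_transport p f).transAt (freelyHomotopic_transport p g) _).transport_homotopic

/-- The map on generalized loops induced by a continuous map. -/
def genLoopMap (e : C(X, Y)) (hy : e x = y) (f : GenLoop N X x) : GenLoop N Y y :=
  ⟨e.comp f.1, fun z hz => (congrArg e (f.2 z hz)).trans hy⟩

omit [Fintype N] in
theorem continuous_genLoopMap (e : C(X, Y)) (hy : e x = y) :
    Continuous (genLoopMap e hy : GenLoop N X x → GenLoop N Y y) :=
  Continuous.subtype_mk ((ContinuousMap.continuous_postcomp e).comp continuous_subtype_val) _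

/-- The homotopy applied to `f` is a free homotopy following the track of the base point, so a map
homotopic to the identity acts as transport. -/
theorem exists_path_transport_genLoopMap {ε : C(X, X)} (h : (ContinuousMap.id X).Homotopic ε) :
    ∃ p : Path x (ε x), ∀ f : GenLoop N X x,
      GenLoop.Homotopic (transport p f) (genLoopMap ε rfl f) := by
  obtain ⟨H⟩ := h
  refine ⟨⟨⟨fun t => H (t, x), by fun_prop⟩, by simp, by simp⟩, fun f =>
    FreelyHomotopic.transport_homotopic ⟨fun t z => H (t, f z), by fun_prop, fun z => by simp,
      fun z => by simp; rfl, fun t z hz => ?_⟩⟩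
  exact congrArg (fun a => H (t, a)) (f.2 z hz)

theorem homotopic_of_genLoopMap {a : C(X, Y)} {b : C(Y, X)}
    (hab : (ContinuousMap.id X).Homotopic (b.comp a)) {f g : GenLoop N X x}
    (h : GenLoop.Homotopic (genLoopMap a rfl f) (genLoopMap a rfl g)) :
    GenLoop.Homotopic f g := by
  obtain ⟨p, hp⟩ := exists_path_transport_genLoopMap (N := N) (x := x) hab
  exact homotopic_of_transport ((hp f).trans ((genLoop_homotopic_map
    (continuous_genLoopMap b rfl) h).trans (hp g).symm))

/-- Homotopy equivalences induce isomorphisms of homotopy groups. -/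
theorem nonempty_mulEquiv_of_homotopyEquiv [DecidableEq N] [Nonempty N] (e : X ≃ₕ Y) (x : X) :
    Nonempty (HomotopyGroup N X x ≃* HomotopyGroup N Y (e.toFun x)) := by
  refine nonempty_mulEquiv_of_genLoop (continuous_genLoopMap e.toFun rfl)
    (fun _ _ => homotopic_of_genLoopMap e.left_inv.symm) (fun g => ?_) (Classical.arbitrary N)
    (Classical.arbitrary N) (fun f g => ?_)
  -- Surjectivity: transport reaches the image of `g` under the inverse, and the inverse is itself
  -- injective on homotopy classes.
  · obtain ⟨p, hp⟩ := exists_path_transport_genLoopMap (N := N) (x := x) e.left_inv.symm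
    obtain ⟨f, hf⟩ := exists_transport_homotopic p (genLoopMap e.invFun rfl g)
    exact ⟨f, homotopic_of_genLoopMap e.right_inv.symm ((hp f).symm.trans hf)⟩
  · have : genLoopMap e.toFun rfl (GenLoop.transAt (Classical.arbitrary N) f g) =
        GenLoop.transAt (Classical.arbitrary N) (genLoopMap e.toFun rfl f)
          (genLoopMap e.toFun rfl g) := by
      ext z
      rw [transAt_apply]
      exact apply_ite e.toFun _ _ _
    rw [this]

end Transport

end HomotopyGroups

/-! ### The loop space of the base and the paths ending in the fiber. -/

section GamLift

variable {S O : Type*} [TopologicalSpace S] [TopologicalSpace O] {f : C(S, O)}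

theorem LiftingFunction.map_apply (L : LiftingFunction f) (p : Delta f) (t : I) :
    f (L.toMap p t) = p.1.2 t :=
  DFunLike.congr_fun (L.comp_map p) t

/-- The projection of `Γ(S, F, s)` to the loop space of the base. -/
def gamDown (f : C(S, O)) (r : O) (s : Fiber f r) : C(Gam (Fiber f r) s, Path r r) where
  toFun α := ⟨f.comp α.1, (congrArg f α.2.1).trans s.2, α.2.2⟩
  continuous_toFun := continuous_induced_rng.2
    ((ContinuousMap.continuous_postcomp f).comp continuous_subtype_val)

/-- The lifts of loops of the base starting at `s`. -/
def gamLift (L : LiftingFunction f) (r : O) (s : Fiber f r) :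
    C(Path r r, Gam (Fiber f r) s) where
  toFun α := ⟨L.toMap ⟨(s, α.toContinuousMap), s.2.trans α.source.symm⟩, L.map_zero _,
    (L.map_apply _ 1).trans α.target⟩
  continuous_toFun := by
    refine Continuous.subtype_mk (L.toMap.continuous.comp (Continuous.subtype_mk ?_ _)) _
    exact continuous_const.prodMk continuous_induced_dom

theorem gamDown_comp_gamLift (L : LiftingFunction f) (r : O) (s : Fiber f r) :
    (gamDown f r s).comp (gamLift L r s) = .id _ := by
  ext α t
  exact L.map_apply _ t

/-- The path `β` from time `m` on, stopped at time `1`. -/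
noncomputable def pathTail (β : C(I, O)) (m : I) : C(I, O) where
  toFun τ := β (Set.projIcc 0 1 zero_le_one (m + τ : ℝ))
  continuous_toFun := β.continuous.comp (continuous_projIcc.comp (by fun_prop))

/-- The path which follows `α` up to time `m` and the lift of the rest of `f ∘ α` afterwards. -/
noncomputable def liftFrom (L : LiftingFunction f) (α : C(I, S)) (m : I) : C(I, S) :=
  L.toMap ⟨(α m, pathTail (f.comp α) m), by
    change f (α m) = f (α (Set.projIcc 0 1 zero_le_one (m + (0 : I) : ℝ)))
    simp⟩

theorem continuous_liftFrom (L : LiftingFunction f) :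
    Continuous fun z : C(I, S) × I => liftFrom L z.1 z.2 := by
  refine L.toMap.continuous.comp (Continuous.subtype_mk (.prodMk (by fun_prop) ?_) _)
  refine ContinuousMap.continuous_of_continuous_uncurry _ ?_
  change Continuous fun w : (C(I, S) × I) × I =>
    f (w.1.1 (Set.projIcc 0 1 zero_le_one (w.1.2 + w.2 : ℝ)))
  have : Continuous fun w : (C(I, S) × I) × I =>
    Set.projIcc (0 : ℝ) 1 zero_le_one (w.1.2 + w.2 : ℝ) := continuous_projIcc.comp (by fun_prop)
  fun_prop

/-- Follow `α` until time `u`, then lift the rest of `f ∘ α` from there. All these paths lie over `f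
∘ α`, so they still end in the fiber; `u = 0` gives the full lift and `u = 1` gives `α`. -/
theorem gamLift_comp_gamDown_homotopic (L : LiftingFunction f) (r : O) (s : Fiber f r) :
    ((gamLift L r s).comp (gamDown f r s)).Homotopic (.id _) := by
  let G : I → C(I, S) → I → S := fun u α t =>
    liftFrom L α (u ⊓ t) (Set.projIcc 0 1 zero_le_one (t - (u ⊓ t : I) : ℝ))
  have hG : Continuous fun w : (I × C(I, S)) × I => G w.1.1 w.1.2 w.2 := by
    have h1 : Continuous fun w : (I × C(I, S)) × I => liftFrom L w.1.2 (w.1.1 ⊓ w.2) :=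
      (continuous_liftFrom L).comp
        (f := fun w : (I × C(I, S)) × I => (w.1.2, w.1.1 ⊓ w.2)) (by fun_prop)
    exact h1.eval (continuous_projIcc.comp (by fun_prop))
  have hGs : ∀ u α, G u α 0 = α 0 := by
    intro u α
    have h0 : u ⊓ 0 = 0 := inf_eq_right.2 u.2.1
    simp only [G, h0, sub_self, projIcc_zero_of_le le_rfl]
    exact L.map_zero _
  have hGf : ∀ u α t, f (G u α t) = f (α t) := by
    intro u α t
    refine (L.map_apply _ _).trans ?_
    change f (α (Set.projIcc 0 1 zero_le_one
      ((u ⊓ t : I) + (Set.projIcc 0 1 zero_le_one (t - (u ⊓ t : I) : ℝ) : I) : ℝ))) = f (α t)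
    have hle : ((u ⊓ t : I) : ℝ) ≤ t := by exact_mod_cast (inf_le_right : u ⊓ t ≤ t)
    have := t.2.2
    have := (u ⊓ t).2.1
    rw [Set.projIcc_of_mem (x := (t - (u ⊓ t : I) : ℝ)) zero_le_one
      ⟨by linarith, by linarith⟩]
    simp
  refine ⟨⟨⟨fun w => ⟨(ContinuousMap.mk _ hG).curry (w.1, w.2.1), (hGs _ _).trans w.2.2.1,
    (hGf _ _ 1).trans w.2.2.2⟩, ?_⟩, fun α => ?_, fun α => ?_⟩⟩
  · refine Continuous.subtype_mk ((ContinuousMap.mk _ hG).curry.continuous.comp ?_) _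
    fun_prop
  · refine Subtype.ext (ContinuousMap.ext fun t => ?_)
    change G 0 α.1 t = L.toMap _ t
    have h0 : 0 ⊓ t = 0 := inf_eq_left.2 t.2.1
    simp only [G, h0, Set.Icc.coe_zero, sub_zero, Set.projIcc_val]
    have : pathTail (f.comp α.1) 0 = (gamDown f r s α).toContinuousMap := by
      ext τ
      change f (α.1 (Set.projIcc 0 1 zero_le_one ((0 : I) + τ : ℝ))) = f (α.1 τ)
      simp
    rw [liftFrom]
    congr 2
    exact Subtype.ext (Prod.ext α.2.1 this)
  · refine Subtype.ext (ContinuousMap.ext fun t => ?_)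
    change G 1 α.1 t = α.1 t
    have h1 : 1 ⊓ t = t := inf_eq_right.2 t.2.2
    simp only [G, h1, sub_self, projIcc_zero_of_le le_rfl]
    exact L.map_zero _

/-- `Γ(S, F, s)` is homotopy equivalent to the loop space of the base. -/
def gamEquiv (L : LiftingFunction f) (r : O) (s : Fiber f r) :
    Path r r ≃ₕ Gam (Fiber f r) s where
  toFun := gamLift L r s
  invFun := gamDown f r s
  left_inv := by rw [gamDown_comp_gamLift]
  right_inv := gamLift_comp_gamDown_homotopic L r s

/-- By definition `lfRestriction` is `gamProj` after `gamLift`. -/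
theorem lfRestriction_comp_gamDown_homotopic (L : LiftingFunction f) (r : O) (s : Fiber f r) :
    ((lfRestriction L r s).comp (gamDown f r s)).Homotopic (gamProj (Fiber f r) s) :=
  ContinuousMap.Homotopic.comp (.refl (gamProj (Fiber f r) s))
    (gamLift_comp_gamDown_homotopic L r s)

end GamLift

/-! ### Strict lifting, and loop spaces as homotopy fibers. -/

section Loops

variable {S : Type*} [TopologicalSpace S]

/-- Maps to `F` which lift to `Γ(S, F, s)` up to homotopy lift strictly. -/
theorem exists_gamProj_comp_eq {Z : Type*} [TopologicalSpace Z] {F : Set S} {s : F}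
    (a : C(Z, Gam F s)) (ξ : C(Z, F)) (h : ((gamProj F s).comp a).Homotopic ξ) :
    ∃ b : C(Z, Gam F s), (gamProj F s).comp b = ξ := by
  obtain ⟨H⟩ := h
  -- The track of `H` stays in `F`; appended to the path `a z`, it moves the end point to `ξ z`. The
  -- constant left leg keeps the start at `s`.
  have hγ : Continuous fun w : Z × I =>
      adjust (fun _ => (s : S)) (a w.1).1 (fun u => (H (u, w.1) : S)) 1 w.2 :=
    continuous_adjust (Z := Z × I) (p := fun _ _ => (s : S)) (γ := fun w => (a w.1).1)
      (q := fun w u => (H (u, w.1) : S)) (u := fun _ => 1) (t := fun w => w.2) (by fun_prop)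
      (by fun_prop) (by fun_prop) (by fun_prop) (by fun_prop) (fun w => (a w.1).2.1.symm)
      (fun w => by simp; rfl)
  have h1 (z : Z) : adjust (fun _ => (s : S)) (a z).1 (fun u => (H (u, z) : S)) 1 1 = ξ z := by
    rw [adjust_target (by simp; rfl)]
    simp
  refine ⟨⟨fun z => ⟨(ContinuousMap.mk _ hγ).curry z,
    adjust_source (fun _ => (s : S)) (a z).1 (fun u => (H (u, z) : S)) 1, ?_⟩,
    Continuous.subtype_mk (ContinuousMap.curry _).continuous _⟩, ?_⟩
  · change adjust (fun _ => (s : S)) (a z).1 (fun u => (H (u, z) : S)) 1 1 ∈ F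
    rw [h1]
    exact (ξ z).2
  · ext z
    exact h1 z

/-- The loop space, as the homotopy equalizer of a pair of points. -/
abbrev LoopEqualizer (s : S) : Set (Unit × C(I, S)) :=
  HomotopyEqualizer (ContinuousMap.const Unit s) (ContinuousMap.const Unit s)

/-- The constant loop. -/
def constLoop (s : S) : LoopEqualizer s := ⟨((), ContinuousMap.const I s), rfl, rfl⟩

/-- The loop space is the space of one-dimensional generalized loops. -/
def loopEqualizerHomeomorph (s : S) : LoopEqualizer s ≃ₜ GenLoop (Fin 1) S s where
  toFun m := ⟨⟨fun z => m.1.2 (z 0), by fun_prop⟩, fun z ⟨i, hi⟩ => by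
    obtain rfl : i = 0 := Subsingleton.elim i 0
    exact hi.elim (fun hi => (congrArg m.1.2 hi).trans m.2.1)
      fun hi => (congrArg m.1.2 hi).trans m.2.2⟩
  invFun p := ⟨((), ⟨fun t => p fun _ => t, by fun_prop⟩), p.2 _ ⟨0, .inl rfl⟩,
    p.2 _ ⟨0, .inr rfl⟩⟩
  left_inv m := rfl
  right_inv p := by
    ext z
    exact congrArg p (funext fun i => congrArg z (Subsingleton.elim 0 i))
  continuous_toFun := Continuous.subtype_mk
    (ContinuousMap.continuous_of_continuous_uncurry _ (by dsimp [Function.uncurry_def]; fun_prop)) _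
  continuous_invFun := Continuous.subtype_mk (continuous_const.prodMk
    (ContinuousMap.continuous_of_continuous_uncurry _
      (by dsimp [Function.uncurry_def]; fun_prop))) _

/-- Every loop can be moved into the component of the constant loop by a self homotopy
equivalence of the loop space. -/
theorem exists_homotopyEquiv_joined_constLoop (s : S) (c : LoopEqualizer s) :
    ∃ e : LoopEqualizer s ≃ₕ LoopEqualizer s, Joined (e.toFun c) (constLoop s) := by
  -- Adjusting by `K` appends the reverse of `c` to a loop; `c` followed by its reverse contracts
  -- through initial segments of `c`.
  let K : (ContinuousMap.const Unit s).Homotopy (ContinuousMap.const Unit s) :=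
    { toFun := fun z => c.1.2 (σ z.1)
      continuous_toFun := by fun_prop
      map_zero_left := fun _ => by rw [unitInterval.symm_zero]; exact c.2.2
      map_one_left := fun _ => by rw [unitInterval.symm_one]; exact c.2.1 }
  let W := HomotopyEqualizer.adjustMap (.refl (.const Unit s)) K
  obtain ⟨V, hV, hV'⟩ := HomotopyEqualizer.isHEquiv_adjustMap (.refl (.const Unit s)) K
  obtain ⟨H⟩ : (W.comp (.const Unit c)).Homotopic (.const Unit (constLoop s)) := by
    refine HomotopyEqualizer.adjustMap_comp_homotopic (fun _ => rfl)
      (fun _ u t => c.1.2 (σ u * t)) (by fun_prop) (fun _ t => by simp) (fun _ t => ?_)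
      (fun _ u => ?_) (fun _ u => ?_)
    · simp only [unitInterval.symm_one, zero_mul]
      exact c.2.1
    · rw [mul_zero]
      exact c.2.1
    · rw [mul_one]
      rfl
  exact ⟨⟨W, V, hV, hV'⟩, ⟨⟨fun t => H (t, ()), by fun_prop⟩, H.apply_zero (), H.apply_one ()⟩⟩

theorem nonempty_mulEquiv_loopEqualizer (s : S) (n : ℕ) : Nonempty
    (HomotopyGroup (Fin (n + 1)) (LoopEqualizer s) (constLoop s) ≃*
      HomotopyGroup.Pi (n + 2) S s) := by
  obtain ⟨a⟩ := nonempty_mulEquiv_of_homotopyEquiv (N := Fin (n + 1))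
    (loopEqualizerHomeomorph s).toHomotopyEquiv (constLoop s)
  obtain ⟨b⟩ := nonempty_mulEquiv_genLoop (M := Fin (n + 1)) (N := Fin 1) (x := s)
  obtain ⟨c⟩ := nonempty_mulEquiv_of_equiv (X := S) (x := s)
    (finSumFinEquiv (m := n + 1) (n := 1))
  exact ⟨(a.trans b).trans c⟩

/-- Homotopy equivalent loop spaces have isomorphic homotopy groups. -/
theorem nonempty_mulEquiv_of_loopEqualizer {S₁ S₂ : Type*} [TopologicalSpace S₁]
    [TopologicalSpace S₂] {s₁ : S₁} {s₂ : S₂} (e : LoopEqualizer s₁ ≃ₕ LoopEqualizer s₂)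
    (n : ℕ) :
    Nonempty (HomotopyGroup.Pi (n + 2) S₁ s₁ ≃* HomotopyGroup.Pi (n + 2) S₂ s₂) := by
  obtain ⟨a₁⟩ := nonempty_mulEquiv_loopEqualizer s₁ n
  obtain ⟨a₂⟩ := nonempty_mulEquiv_loopEqualizer s₂ n
  -- `e` may send the constant loop to another component of the loop space; `w` corrects this before
  -- base points are compared.
  obtain ⟨w, hw⟩ := exists_homotopyEquiv_joined_constLoop s₂ (e.toFun (constLoop s₁))
  obtain ⟨b⟩ := nonempty_mulEquiv_of_homotopyEquiv (N := Fin (n + 1)) (e.trans w) (constLoop s₁)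
  obtain ⟨c⟩ := nonempty_mulEquiv_of_joined (N := Fin (n + 1)) hw
  exact ⟨a₁.symm.trans ((b.trans c).trans a₂)⟩

/-- The space of paths in `F` ending at `s`. -/
def PathsTo {F : Type*} [TopologicalSpace F] (s : F) : Set C(I, F) := {γ | γ 1 = s}

/-- The space of paths ending at a point is contractible. -/
noncomputable def pathsToEquiv {F : Type*} [TopologicalSpace F] (s : F) : Unit ≃ₕ PathsTo s where
  toFun := .const Unit ⟨.const I s, rfl⟩
  invFun := .const _ ()
  left_inv := .refl _
  right_inv := by
    have hG : Continuous fun w : (I × PathsTo s) × I => w.1.2.1 (w.2 ⊔ σ w.1.1) := by fun_prop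
    have hmem (w : I × PathsTo s) : (ContinuousMap.mk _ hG).curry w ∈ PathsTo s := by
      change w.2.1 (1 ⊔ σ w.1) = s
      have : 1 ⊔ σ w.1 = 1 := sup_eq_left.2 (σ w.1).2.2
      rw [this]
      exact w.2.2
    refine ⟨⟨⟨fun w => ⟨(ContinuousMap.mk _ hG).curry w, hmem w⟩,
      (ContinuousMap.mk _ hG).curry.continuous.subtype_mk hmem⟩, fun γ => ?_, fun γ => ?_⟩⟩
    · refine Subtype.ext (ContinuousMap.ext fun t => ?_)
      change γ.1 (t ⊔ σ 0) = s
      have : t ⊔ 1 = 1 := sup_eq_right.2 t.2.2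
      rw [unitInterval.symm_zero, this]
      exact γ.2
    · refine Subtype.ext (ContinuousMap.ext fun t => ?_)
      change γ.1 (t ⊔ σ 1) = γ.1 t
      have : t ⊔ 0 = t := sup_eq_left.2 t.2.1
      rw [unitInterval.symm_one, this]

/-- The starting point, in `S`, of a path in `F ⊆ S`. -/
def pathsToStart (F : Set S) (s : F) : C(PathsTo s, S) := ⟨fun γ => γ.1 0, by fun_prop⟩

/-- Exchange of the two paths making up a point of the homotopy fibre of
`Γ(S, F, s) → F`. -/
def pathsToHomeomorph (F : Set S) (s : F) :
    HomotopyEqualizer (ContinuousMap.const (PathsTo s) (s : S)) (pathsToStart F s) ≃ₜ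
      HomotopyEqualizer (gamProj F s) (ContinuousMap.const (Gam F s) s) where
  toFun m := ⟨(⟨m.1.2, m.2.1, by rw [m.2.2]; exact (m.1.1.1 0).2⟩, m.1.1.1),
    Subtype.ext m.2.2.symm, m.1.1.2⟩
  invFun m := ⟨(⟨m.1.2, m.2.2⟩, m.1.1.1), m.1.1.2.1, congrArg Subtype.val m.2.1.symm⟩
  left_inv _ := rfl
  right_inv _ := rfl
  continuous_toFun := by fun_prop
  continuous_invFun := by fun_prop

/-- The homotopy fibre of `Γ(S, F, s) → F` is the loop space of `S`. -/
theorem nonempty_loopEqualizer_equiv_gamProj (F : Set S) (s : F) :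
    Nonempty (LoopEqualizer (s : S) ≃ₕ
      HomotopyEqualizer (gamProj F s) (ContinuousMap.const (Gam F s) s)) := by
  -- A point of the homotopy fiber is a path in `F` ending at `s` with a path in `S` from `s` to its
  -- start. Paths in `F` ending at `s` contract to the constant one, which leaves loops at `s`.
  obtain ⟨e⟩ := (HomotopyEqualizer.isHEquiv_pullMap
    (φ := ContinuousMap.const (PathsTo s) (s : S)) (ψ := pathsToStart F s)
    (φ' := ContinuousMap.const Unit (s : S)) (ψ' := ContinuousMap.const Unit (s : S))
    (pathsToEquiv s) (fun _ => rfl) (fun _ => rfl)).nonempty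
  exact ⟨e.trans (pathsToHomeomorph F s).toHomotopyEquiv⟩

/-- The homotopy fibre of an `Lf`-restriction is the loop space of the total space. -/
theorem nonempty_loopEqualizer_equiv_lfRestriction {O : Type*} [TopologicalSpace O] {f : C(S, O)}
    (L : LiftingFunction f) (r : O) (s : Fiber f r) :
    Nonempty (LoopEqualizer (s : S) ≃ₕ
      HomotopyEqualizer (lfRestriction L r s) (ContinuousMap.const (Path r r) s)) := by
  obtain ⟨a⟩ := nonempty_loopEqualizer_equiv_gamProj (Fiber f r) s
  obtain ⟨b⟩ := (HomotopyEqualizer.isHEquiv_pullMap (φ := gamProj (Fiber f r) s)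
    (ψ := ContinuousMap.const _ s) (φ' := lfRestriction L r s) (ψ' := ContinuousMap.const _ s)
    (gamEquiv L r s) (fun _ => rfl) (fun _ => rfl)).nonempty
  exact ⟨a.trans b.symm⟩

end Loops

/-! ### Consequences of conjugacy. -/

section Conjugate

variable {S₁ S₂ O : Type*} [TopologicalSpace S₁] [TopologicalSpace S₂] [TopologicalSpace O]
  {f₁ : C(S₁, O)} {f₂ : C(S₂, O)} {L₁ : LiftingFunction f₁} {L₂ : LiftingFunction f₂} {r : O}
  {g : Fiber f₁ r ≃ₕ Fiber f₂ r}

theorem ConjugateLfFunctions.conjugateLfRestrictions (h : ConjugateLfFunctions L₁ L₂ r g)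
    (s : Fiber f₁ r) : ConjugateLfRestrictions L₁ L₂ r g s :=
  ContinuousMap.Homotopic.comp h
    (.refl ((ContinuousMap.id (Path r r)).prodMk (ContinuousMap.const (Path r r) s)))

theorem const_homotopic_const_invFun_toFun (Z : Type*) [TopologicalSpace Z] (s : Fiber f₁ r) :
    (ContinuousMap.const Z s).Homotopic (.const Z (g.invFun (g.toFun s))) :=
  ContinuousMap.Homotopic.comp g.left_inv.symm (.refl (ContinuousMap.const Z s))

namespace ConjugateLfRestrictions

variable {s : Fiber f₁ r}

/-- Composing the conjugacy with `g` gives `f₂^{g(s)} ≃ g ∘ f₁^s`. So projecting to `O` and lifting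
to `S₂` covers `g` up to homotopy, and the result is made strict. -/
theorem exists_fiberMap (h : ConjugateLfRestrictions L₁ L₂ r g s) :
    ∃ k : C(Gam (Fiber f₁ r) s, Gam (Fiber f₂ r) (g.toFun s)),
      IsFiberMapOver (gamProj (Fiber f₁ r) s) (gamProj (Fiber f₂ r) (g.toFun s)) k g.toFun := by
  refine exists_gamProj_comp_eq ((gamLift L₂ r (g.toFun s)).comp (gamDown f₁ r s)) _ ?_
  have h₁ : (lfRestriction L₂ r (g.toFun s)).Homotopic
      (g.toFun.comp (g.invFun.comp (lfRestriction L₂ r (g.toFun s)))) :=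
    ContinuousMap.Homotopic.comp g.right_inv.symm (.refl (lfRestriction L₂ r (g.toFun s)))
  have h₂ : (lfRestriction L₂ r (g.toFun s)).Homotopic (g.toFun.comp (lfRestriction L₁ r s)) :=
    h₁.trans (.comp (.refl g.toFun) (ContinuousMap.Homotopic.symm h))
  have h₃ : ((lfRestriction L₂ r (g.toFun s)).comp (gamDown f₁ r s)).Homotopic
      ((g.toFun.comp (lfRestriction L₁ r s)).comp (gamDown f₁ r s)) :=
    .comp h₂ (.refl _)
  exact h₃.trans (.comp (.refl g.toFun) (lfRestriction_comp_gamDown_homotopic L₁ r s))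

theorem exists_fiberMap_inv (h : ConjugateLfRestrictions L₁ L₂ r g s) :
    ∃ k : C(Gam (Fiber f₂ r) (g.toFun s), Gam (Fiber f₁ r) (g.invFun (g.toFun s))),
      IsFiberMapOver (gamProj (Fiber f₂ r) (g.toFun s))
        (gamProj (Fiber f₁ r) (g.invFun (g.toFun s))) k g.invFun := by
  refine exists_gamProj_comp_eq
    ((gamLift L₁ r (g.invFun (g.toFun s))).comp (gamDown f₂ r (g.toFun s))) _ ?_
  -- The homotopy from the identity to `ḡ ∘ g` joins `s` to `ḡ(g(s))` inside the fiber.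
  have h₁ : (lfRestriction L₁ r (g.invFun (g.toFun s))).Homotopic (lfRestriction L₁ r s) :=
    .comp (.refl _) (.prodMk (.refl _) (const_homotopic_const_invFun_toFun _ s).symm)
  have h₂ : ((lfRestriction L₁ r (g.invFun (g.toFun s))).comp
      (gamDown f₂ r (g.toFun s))).Homotopic
      ((g.invFun.comp (lfRestriction L₂ r (g.toFun s))).comp (gamDown f₂ r (g.toFun s))) :=
    .comp (h₁.trans h) (.refl _)
  exact h₂.trans
    (.comp (.refl g.invFun) (lfRestriction_comp_gamDown_homotopic L₂ r (g.toFun s)))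

/-- Both homotopy fibers are compared with the homotopy equalizer of `ḡ ∘ f₂^{g(s)}` and the
constant `ḡ(g(s))`: the first by adjusting end points, the second by pushing along `ḡ`. -/
theorem nonempty_loopEqualizer_equiv (h : ConjugateLfRestrictions L₁ L₂ r g s) :
    Nonempty (LoopEqualizer (s : S₁) ≃ₕ LoopEqualizer ((g.toFun s : Fiber f₂ r) : S₂)) := by
  obtain ⟨a₁⟩ := nonempty_loopEqualizer_equiv_lfRestriction L₁ r s
  obtain ⟨a₂⟩ := nonempty_loopEqualizer_equiv_lfRestriction L₂ r (g.toFun s)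
  obtain ⟨H⟩ := h
  obtain ⟨K⟩ := const_homotopic_const_invFun_toFun (g := g) (Path r r) s
  obtain ⟨b⟩ := (HomotopyEqualizer.isHEquiv_adjustMap H K).nonempty
  obtain ⟨c⟩ := (HomotopyEqualizer.isHEquiv_pushMap (φ := lfRestriction L₂ r (g.toFun s))
    (ψ := .const _ (g.toFun s)) (φ' := g.invFun.comp (lfRestriction L₂ r (g.toFun s)))
    (ψ' := .const _ (g.invFun (g.toFun s))) g.symm (fun _ => rfl) (fun _ => rfl)).nonempty
  exact ⟨(a₁.trans b).trans (c.symm.trans a₂.symm)⟩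

end ConjugateLfRestrictions

end Conjugate

end LfFibration

theorem mainTheorem9 {S₁ S₂ O : Type*} [TopologicalSpace S₁] [TopologicalSpace S₂]
    [TopologicalSpace O] (f₁ : C(S₁, O)) (f₂ : C(S₂, O))
    (hf₁ : LfFibration.IsRegularFibration f₁) (hf₂ : LfFibration.IsRegularFibration f₂)
    (L₁ : LfFibration.LiftingFunction f₁) (L₂ : LfFibration.LiftingFunction f₂) (r₀ : O)
    (g : LfFibration.Fiber f₁ r₀ ≃ₕ LfFibration.Fiber f₂ r₀)
    (hg : LfFibration.ConjugateLfFunctions L₁ L₂ r₀ g) :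
    ∀ s₀ : LfFibration.Fiber f₁ r₀,
      LfFibration.ConjugateLfRestrictions L₁ L₂ r₀ g s₀ ∧
      (∃ h : C(LfFibration.Gam (LfFibration.Fiber f₁ r₀) s₀,
            LfFibration.Gam (LfFibration.Fiber f₂ r₀) (g.toFun s₀)),
          LfFibration.IsFiberMapOver (LfFibration.gamProj (LfFibration.Fiber f₁ r₀) s₀)
            (LfFibration.gamProj (LfFibration.Fiber f₂ r₀) (g.toFun s₀)) h g.toFun) ∧
      (∃ k : C(LfFibration.Gam (LfFibration.Fiber f₂ r₀) (g.toFun s₀),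
            LfFibration.Gam (LfFibration.Fiber f₁ r₀) (g.invFun (g.toFun s₀))),
          LfFibration.IsFiberMapOver (LfFibration.gamProj (LfFibration.Fiber f₂ r₀) (g.toFun s₀))
            (LfFibration.gamProj (LfFibration.Fiber f₁ r₀) (g.invFun (g.toFun s₀))) k g.invFun) ∧
      (∀ n : ℕ, 1 < n → ∀ [Nonempty (Fin n)],
        Nonempty (HomotopyGroup.Pi n S₁ (s₀ : S₁) ≃*
          HomotopyGroup.Pi n S₂ ((g.toFun s₀ : LfFibration.Fiber f₂ r₀) : S₂))) := by
  intro s₀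
  have h := hg.conjugateLfRestrictions s₀
  refine ⟨h, h.exists_fiberMap, h.exists_fiberMap_inv, fun n hn _ => ?_⟩
  obtain ⟨e⟩ := h.nonempty_loopEqualizer_equiv
  obtain ⟨m, rfl⟩ := Nat.exists_eq_add_of_le' hn
  exact LfFibration.nonempty_mulEquiv_of_loopEqualizer e m
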